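/- Let $A$ be a discrete valuation ring with local parameter $x$, let $A'$ be its completion, let $B=A[Y]/I$ with $Y=(Y_1,\ldots,Y_n)$ and $I\subset A[Y]$ an ideal, and let $c\in\mathbb N$. Let $f=(f_1,\ldots,f_r)$, $r\le n$, be a system of polynomials from $I$, let $M$ be an $r\times r$-minor of the Jacobian matrix $(\partial f_i/\partial Y_j)$, and let $N\in ((f):I)$. Let $v:B\to A'/(x^{2c+1})$ be an $A$-morphism with $v(NM+I)\notin (x)^c/(x^{2c+1})$. Suppose that the set $$S=\{v'\in \mathrm{Hom}_A(B,A') : v'\equiv v \ \text{modulo}\ x^{2c+1}\}$$ is not empty. Then there is a canonical bijection $A'^s\to S$ for some $s\in\mathbb N$. More precisely, there are $s\in\mathbb N$ and elements $Z_1,\ldots,Z_s\in B$ such that for every $v_0\in S$ there is a bijection $\varphi:A'^s\to S$ with $$\varphi(z)(Z_j)=v_0(Z_j)+x^{2c+1}z_j\qquad (z\in A'^s,\ 1\le j\le s),$$ so that $\varphi(z)$ is the unique $v'\in S$ with $v'(Z_j)=v_0(Z_j)+x^{2c+1}z_j$ for all $j$. -/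

import Mathlib

/-- The completion `A'` of a local ring `A` with respect to its maximal ideal. -/
abbrev LocalCompletion (A : Type*) [CommRing A] [IsLocalRing A] : Type _ :=
  AdicCompletion (IsLocalRing.maximalIdeal A) A

/-- The ideal `(x ^ k)` of the completion `A'`. -/
noncomputable def powIdeal {A : Type*} [CommRing A] [IsLocalRing A] (x : A) (k : ℕ) : Ideal (LocalCompletion A) :=
  Ideal.span {algebraMap A (LocalCompletion A) x ^ k}

/-- The `r × r` minor, on the columns selected by `e`, of the Jacobian matrix
`(∂ f_i / ∂ Y_j)` of a system of polynomials `f = (f_1, …, f_r)` in `n` variables. -/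
noncomputable def jacobianMinor {A : Type*} [CommRing A] {n r : ℕ}
    (f : Fin r → MvPolynomial (Fin n) A) (e : Fin r ↪o Fin n) : MvPolynomial (Fin n) A :=
  (Matrix.of fun i j => MvPolynomial.pderiv (e j) (f i)).det

/-- The set of all `A`-morphisms `v' : B → A'` with `v' ≡ v` modulo `x ^ k`, for a given
`A`-morphism `v : B → A' / (x ^ k)`. -/
def liftSet {A B : Type*} [CommRing A] [IsLocalRing A] [CommRing B] [Algebra A B]
    (x : A) (k : ℕ) (v : B →ₐ[A] LocalCompletion A ⧸ powIdeal x k) : Set (B →ₐ[A] LocalCompletion A) :=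
  {v' | ∀ b : B, Ideal.Quotient.mk (powIdeal x k) (v' b) = v b}

/-! Fix one lift, seen as a point `y` of `A'^n` where `I` vanishes, and put `t = x^(2c+1)`. The
other lifts are the points `y + t w` on which `I` vanishes. By Taylor expansion, `f(y + t w) = t (J
w + t Q(w))` with `J` the Jacobian matrix at `y`. Since `x^c` does not divide `NM` at `y`, an `r ×
r` minor `d` of least valuation has valuation below `c`, so `d x` divides `t`. Multiplying by the
adjugate and dividing by `d` turns `J w + t Q(w) = 0` into a system with the identity matrix on the
columns of that minor and nonlinear terms divisible by `x`. It is contracting in those coordinates,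
while the others are free (`existsUnique_mulVec_add_eq_zero`); the classes of the free variables are
the `Z_j`. Zeros of `f` near `y` are zeros of `I`, because `N I ⊆ (f)` and `N` does not vanish
there. -/

theorem pow_smul_top_smodEq_iff {R : Type*} [CommRing R] (x a b : R) (k : ℕ) :
    a ≡ b [SMOD (Ideal.span {x} ^ k • ⊤ : Submodule R R)] ↔ x ^ k ∣ a - b := by
  rw [SModEq.sub_mem, smul_eq_mul, Ideal.mul_top, Ideal.span_singleton_pow,
    Ideal.mem_span_singleton]

theorem eq_of_forall_pow_dvd_sub {R : Type*} [CommRing R] {x : R}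
    [IsHausdorff (Ideal.span {x}) R] {a b : R} (h : ∀ k : ℕ, x ^ k ∣ a - b) : a = b :=
  sub_eq_zero.mp <| IsHausdorff.haus ‹_› _ fun k => by
    rw [pow_smul_top_smodEq_iff, sub_zero]
    exact h k

/-- Fixed point theorem for maps of `ι → R` contracting in the `x`-adic topology. -/
theorem existsUnique_fixedPoint_of_contracting {R ι : Type*} [CommRing R] {x : R}
    [IsAdicComplete (Ideal.span {x}) R] (F : (ι → R) → ι → R)
    (hF : ∀ (k : ℕ) (u w : ι → R), (∀ i, x ^ k ∣ u i - w i) →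
      ∀ i, x ^ (k + 1) ∣ F u i - F w i) :
    ∃! u, F u = u := by
  have step : ∀ (k m : ℕ) (i : ι), x ^ k ∣ F^[k] 0 i - F^[k + m] 0 i := by
    intro k
    induction k with
    | zero => simp
    | succ k ih =>
      intro m
      rw [Nat.add_right_comm, Function.iterate_succ_apply', Function.iterate_succ_apply']
      exact hF k _ _ (ih m)
  have lim : ∀ i, ∃ L : R, ∀ k, x ^ k ∣ F^[k] 0 i - L := by
    intro i
    obtain ⟨L, hL⟩ := IsPrecomplete.prec (I := Ideal.span {x}) (M := R) inferInstance
      (f := fun k => F^[k] 0 i) (fun {m n} hmn => by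
        obtain ⟨d, rfl⟩ := Nat.exists_eq_add_of_le hmn
        exact (pow_smul_top_smodEq_iff _ _ _ _).mpr (step m d i))
    exact ⟨L, fun k => (pow_smul_top_smodEq_iff _ _ _ _).mp (hL k)⟩
  choose L hL using lim
  refine ⟨L, ?_, ?_⟩
  · funext i
    refine eq_of_forall_pow_dvd_sub (x := x) fun k => ?_
    have h1 := hF k _ _ (fun i => hL i k) i
    have h2 := hL i (k + 1)
    rw [Function.iterate_succ_apply'] at h2
    have h3 := dvd_sub h2 h1
    rw [sub_sub_sub_cancel_left] at h3
    exact (pow_dvd_pow x k.le_succ).trans h3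
  · intro w hw
    have key : ∀ (k : ℕ) (i : ι), x ^ k ∣ w i - F^[k] 0 i := by
      intro k
      induction k with
      | zero => simp
      | succ k ih =>
        rw [Function.iterate_succ_apply']
        nth_rewrite 1 [← hw]
        exact hF k _ _ ih
    funext i
    refine eq_of_forall_pow_dvd_sub (x := x) fun k => ?_
    have := dvd_add (key k i) (hL i k)
    rwa [sub_add_sub_cancel] at this

/-! ### Polynomial congruences and Taylor expansion -/

theorem MvPolynomial.dvd_eval_sub_eval {R σ : Type*} [CommRing R] (q : MvPolynomial σ R) {a : R}
    {u w : σ → R} (h : ∀ i, a ∣ u i - w i) : a ∣ eval u q - eval w q := by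
  induction q using MvPolynomial.induction_on with
  | C b => simp
  | add p q hp hq =>
    rw [map_add, map_add, add_sub_add_comm]
    exact dvd_add hp hq
  | mul_X p i hp =>
    simp only [map_mul, eval_X]
    exact dvd_mul_sub_mul hp (h i)

/-- Taylor expansion of a polynomial to second order in the increment `t * w`. -/
theorem MvPolynomial.exists_aeval_add_mul_eq {A R σ : Type*} [CommRing A] [CommRing R]
    [Algebra A R] [Fintype σ] (p : MvPolynomial σ A) (y : σ → R) (t : R) :
    ∃ q : MvPolynomial σ R, ∀ w : σ → R, aeval (fun k => y k + t * w k) p =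
      aeval y p + t * ∑ k, aeval y (pderiv k p) * w k + t ^ 2 * eval w q := by
  induction p using MvPolynomial.induction_on with
  | C a => exact ⟨0, by simp⟩
  | add p p' hp hp' =>
    obtain ⟨q, hq⟩ := hp
    obtain ⟨q', hq'⟩ := hp'
    refine ⟨q + q', fun w => ?_⟩
    simp only [map_add, hq, hq', add_mul, Finset.sum_add_distrib]
    ring
  | mul_X p i hp =>
    classical
    obtain ⟨q, hq⟩ := hp
    refine ⟨(∑ k, C (aeval y (pderiv k p)) * X k) * X i + q * C (y i) + C t * (q * X i),
      fun w => ?_⟩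
    have hsum : ∑ k, aeval y (pderiv k (p * X i)) * w k =
        (∑ k, aeval y (pderiv k p) * w k) * y i + aeval y p * w i := by
      have (k : σ) : aeval y (pderiv k (p * X i)) * w k =
          aeval y (pderiv k p) * w k * y i + if i = k then aeval y p * w k else 0 := by
        rw [Derivation.leibniz, pderiv_X, smul_eq_mul, smul_eq_mul]
        by_cases hik : i = k
        · subst hik
          simp
          ring
        · simp [hik]
          ring
      simp only [this, Finset.sum_add_distrib, Finset.sum_mul, Finset.sum_ite_eq,
        Finset.mem_univ, if_true]
    rw [hsum]
    simp only [map_mul, map_add, map_sum, aeval_X, eval_X, eval_C, hq]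
    ring

/-! ### Minors and the implicit function theorem -/

section Matrix

open scoped Matrix

/-- If divisibility is total, some maximal minor divides all the others. -/
theorem Matrix.exists_det_submatrix_dvd {R ι κ : Type*} [CommRing R] [Fintype ι] [DecidableEq ι]
    [Finite κ] (hR : ∀ a b : R, a ∣ b ∨ b ∣ a) (J : Matrix ι κ R) (e : ι → κ) :
    ∃ g : ι → κ, ∀ h : ι → κ, (J.submatrix id g).det ∣ (J.submatrix id h).det := by
  have : Nonempty (ι → κ) := ⟨e⟩
  have D : Directed (fun a b : R => b ∣ a) fun g : ι → κ => (J.submatrix id g).det := fun g h =>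
    (hR (J.submatrix id g).det (J.submatrix id h).det).elim
      (fun H => ⟨g, dvd_rfl, H⟩) (fun H => ⟨h, H, dvd_rfl⟩)
  have : IsTrans R fun a b : R => b ∣ a := ⟨fun _ _ _ hab hbc => hbc.trans hab⟩
  exact D.finite_le id

/-- Cramer's rule. Each entry is again a maximal minor, hence divisible by one of least valuation.
-/
theorem Matrix.adjugate_submatrix_mul_apply {R ι κ : Type*} [CommRing R] [Fintype ι]
    [DecidableEq ι] (J : Matrix ι κ R) (g : ι → κ) (i : ι) (k : κ) :
    ((J.submatrix id g).adjugate * J) i k = (J.submatrix id (Function.update g i k)).det := by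
  have h : ((J.submatrix id g).adjugate * J) i k =
      ((J.submatrix id g).adjugate *ᵥ fun l => J l k) i := rfl
  rw [h, ← Matrix.cramer_eq_adjugate_mulVec, Matrix.cramer_apply]
  congr 1
  ext a b
  by_cases hb : b = i
  · subst hb
    simp
  · simp [hb]

/-- An injection of finite types extends to an equivalence from a disjoint sum. -/
theorem exists_equiv_sum_fin_of_injective {ι κ : Type*} [Finite κ] {g : ι → κ}
    (hg : Function.Injective g) :
    ∃ (s : ℕ) (σ : ι ⊕ Fin s ≃ κ), ∀ i, σ (Sum.inl i) = g i := by
  classical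
  obtain ⟨s, ⟨τ⟩⟩ := Finite.exists_equiv_fin ((Set.range g)ᶜ : Set κ)
  exact ⟨s, ((Equiv.ofInjective g hg).sumCongr τ.symm).trans (Equiv.Set.sumCompl (Set.range g)),
    fun i => by simp⟩

/-- Implicit function theorem over an `x`-adically complete ring: if some maximal minor of `J`
strictly divides `t` and divides all other maximal minors, then the solutions of
`J w + t Q(w) = 0` are parametrized by the coordinates outside that minor. -/
theorem existsUnique_mulVec_add_eq_zero {R ι κ : Type*} [CommRing R] [IsDomain R] [Fintype ι]
    [DecidableEq ι] [Fintype κ] {x : R} [IsAdicComplete (Ideal.span {x}) R]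
    (J : Matrix ι κ R) (Q : ι → MvPolynomial κ R) (t : R) (g : ι → κ)
    (hg : ∀ h : ι → κ, (J.submatrix id g).det ∣ (J.submatrix id h).det)
    (h0 : (J.submatrix id g).det ≠ 0) (ht : (J.submatrix id g).det * x ∣ t) :
    ∃ (s : ℕ) (τ : Fin s → κ), ∀ z : Fin s → R,
      ∃! w : κ → R, (∀ i, ∑ k, J i k * w k + t * MvPolynomial.eval w (Q i) = 0) ∧
        ∀ j, w (τ j) = z j := by
  set d := (J.submatrix id g).det
  set B := (J.submatrix id g).adjugate with hB
  obtain ⟨b, hb⟩ := ht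
  have hT : ∀ i k, ∃ T : R, (B * J) i k = d * T := fun i k => by
    rw [hB, Matrix.adjugate_submatrix_mul_apply]
    exact hg _
  choose T hT using hT
  -- On the columns of `g`, the adjugate times `J` is `d` times the identity.
  have hTg : ∀ i i', T i (g i') = if i = i' then 1 else 0 := fun i i' => by
    apply mul_left_cancel₀ h0
    rw [← hT]
    have : (B * J) i (g i') = _ :=
      congr_fun (congr_fun (Matrix.adjugate_mul (J.submatrix id g)) i) i'
    rw [this, Matrix.smul_apply, Matrix.one_apply, smul_eq_mul]
  have hinj : Function.Injective g := fun a a' haa => by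
    by_contra hne
    have h1 := hTg a a
    rw [haa, hTg, if_neg hne, if_pos rfl] at h1
    exact zero_ne_one h1
  obtain ⟨s, σ, hσ⟩ := exists_equiv_sum_fin_of_injective hinj
  refine ⟨s, fun j => σ (Sum.inr j), fun z => ?_⟩
  -- Nothing is lost: multiplying back by the submatrix gives `d` times the original system, and `d`
  -- is cancellable.
  have reduce : ∀ w : κ → R,
      (∀ i, ∑ k, J i k * w k + t * MvPolynomial.eval w (Q i) = 0) ↔
      ∀ i, ∑ k, T i k * w k + x * (b * ∑ l, B i l * MvPolynomial.eval w (Q l)) = 0 := by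
    intro w
    set V : ι → R := fun i => ∑ k, J i k * w k + t * MvPolynomial.eval w (Q i) with hV
    have hBV : ∀ i, (B *ᵥ V) i =
        d * (∑ k, T i k * w k + x * (b * ∑ l, B i l * MvPolynomial.eval w (Q l))) := by
      intro i
      have hV' : V = J *ᵥ w + t • fun i => MvPolynomial.eval w (Q i) := rfl
      rw [hV', Matrix.mulVec_add, Matrix.mulVec_smul, Matrix.mulVec_mulVec]
      have h1 : ((B * J) *ᵥ w) i = d * ∑ k, T i k * w k := by
        simp only [Matrix.mulVec, dotProduct, hT, Finset.mul_sum, mul_assoc]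
      rw [Pi.add_apply, h1, Pi.smul_apply, smul_eq_mul, hb]
      simp only [Matrix.mulVec, dotProduct]
      ring
    have hdV : ∀ i, d * V i = (J.submatrix id g *ᵥ (B *ᵥ V)) i := by
      intro i
      rw [Matrix.mulVec_mulVec, hB, Matrix.mul_adjugate, Matrix.smul_mulVec, Matrix.one_mulVec]
      rfl
    constructor
    · intro h i
      have hV0 : V = 0 := funext h
      have := hBV i
      rw [hV0, Matrix.mulVec_zero] at this
      exact (mul_eq_zero.mp this.symm).resolve_left h0
    · intro h i
      have hBV0 : B *ᵥ V = 0 := funext fun i => by rw [hBV, h, mul_zero]; rfl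
      have := hdV i
      rw [hBV0, Matrix.mulVec_zero] at this
      exact (mul_eq_zero.mp this).resolve_left h0
  set E : (ι → R) → κ → R := fun u k => Sum.elim u z (σ.symm k) with hE
  have split : ∀ (w : κ → R) (i : ι), ∑ k, T i k * w k =
      w (σ (Sum.inl i)) + ∑ j, T i (σ (Sum.inr j)) * w (σ (Sum.inr j)) := by
    intro w i
    rw [← σ.sum_comp, Fintype.sum_sum_type]
    simp [hσ, hTg]
  -- Solve for the coordinates in the minor with the others fixed at `z`; the spare factor `x` makes
  -- the map contracting.
  obtain ⟨u, hu, huniq⟩ := existsUnique_fixedPoint_of_contracting (x := x)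
    (fun (u : ι → R) i => -(∑ j, T i (σ (Sum.inr j)) * z j) -
      x * (b * ∑ l, B i l * MvPolynomial.eval (E u) (Q l))) (by
    intro k u w h i
    rw [sub_sub_sub_cancel_left, ← mul_sub, ← mul_sub, ← Finset.sum_sub_distrib, pow_succ']
    refine mul_dvd_mul_left x (Dvd.dvd.mul_left (Finset.dvd_sum fun l _ => ?_) b)
    rw [← mul_sub]
    refine Dvd.dvd.mul_left (MvPolynomial.dvd_eval_sub_eval _ fun m => ?_) _
    rw [dvd_sub_comm]
    simp only [hE]
    cases σ.symm m with
    | inl i => exact h i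
    | inr j => simp)
  refine ⟨E u, ⟨(reduce _).mpr fun i => ?_, fun j => by simp [hE]⟩, ?_⟩
  · have := congr_fun hu i
    rw [split]
    simp only [hE, Equiv.symm_apply_apply, Sum.elim_inl, Sum.elim_inr] at this ⊢
    linear_combination -this
  · rintro w ⟨hw, hwz⟩
    have hwE : E (fun i => w (σ (Sum.inl i))) = w := by
      funext k
      obtain ⟨m, rfl⟩ := σ.surjective k
      cases m <;> simp [hE, hwz]
    rw [← huniq (fun i => w (σ (Sum.inl i))), hwE]
    funext i
    have := (reduce w).mp hw i
    rw [split] at this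
    simp only [hwE, ← hwz]
    linear_combination -this

end Matrix

/-! ### Lifts of a solution -/

theorem exists_eq_pow_mul_isUnit {R : Type*} [CommRing R] {x : R} [IsHausdorff (Ideal.span {x}) R]
    (hu : ∀ a : R, ¬ x ∣ a → IsUnit a) {a : R} (ha : a ≠ 0) :
    ∃ (m : ℕ) (u : R), IsUnit u ∧ a = x ^ m * u := by
  have hfin : FiniteMultiplicity x a := by
    by_contra h
    rw [FiniteMultiplicity.not_iff_forall] at h
    exact ha (eq_of_forall_pow_dvd_sub (x := x) fun k => by simpa using h k)
  obtain ⟨u, hau, hxu⟩ := hfin.exists_eq_pow_mul_and_not_dvd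
  exact ⟨_, u, hu u hxu, hau⟩

/-- The lifts of a solution that are congruent to it modulo a high power of a uniformizer are
parametrized by their values on finitely many elements. -/
theorem existsUnique_algHom_of_jacobianMinor {A R : Type*} [CommRing A] [CommRing R] [IsDomain R]
    [Algebra A R] {x : R} [IsAdicComplete (Ideal.span {x}) R] (hx : x ≠ 0)
    (hu : ∀ a : R, ¬ x ∣ a → IsUnit a) {n r : ℕ} (c : ℕ) (I : Ideal (MvPolynomial (Fin n) A))
    (v₀ : (MvPolynomial (Fin n) A ⧸ I) →ₐ[A] R)
    (f : Fin r → MvPolynomial (Fin n) A) (hf : ∀ i, f i ∈ I) (e : Fin r ↪o Fin n)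
    (N : MvPolynomial (Fin n) A)
    (hN : N ∈ (Ideal.span (Set.range f)).colon (I : Set (MvPolynomial (Fin n) A)))
    (hNM : ¬ x ^ c ∣ v₀ (Ideal.Quotient.mk I (N * jacobianMinor f e))) :
    ∃ (s : ℕ) (Z : Fin s → MvPolynomial (Fin n) A ⧸ I), ∀ z : Fin s → R,
      ∃! v' : (MvPolynomial (Fin n) A ⧸ I) →ₐ[A] R,
        (∀ b, x ^ (2 * c + 1) ∣ v' b - v₀ b) ∧
          ∀ j, v' (Z j) = v₀ (Z j) + x ^ (2 * c + 1) * z j := by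
  set t := x ^ (2 * c + 1) with ht
  have ht0 : t ≠ 0 := pow_ne_zero _ hx
  have hat : ∀ (v : (MvPolynomial (Fin n) A ⧸ I) →ₐ[A] R) (p : MvPolynomial (Fin n) A),
      MvPolynomial.aeval (fun k => v (Ideal.Quotient.mk I (MvPolynomial.X k))) p =
        v (Ideal.Quotient.mk I p) := fun v p =>
    DFunLike.congr_fun (MvPolynomial.algHom_ext
      (f := MvPolynomial.aeval fun k => v (Ideal.Quotient.mk I (MvPolynomial.X k)))
      (g := v.comp (Ideal.Quotient.mkₐ A I)) fun k => by simp) p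
  set y : Fin n → R := fun k => v₀ (Ideal.Quotient.mk I (MvPolynomial.X k)) with hy
  have hroot : ∀ (v : (MvPolynomial (Fin n) A ⧸ I) →ₐ[A] R), ∀ p ∈ I,
      v (Ideal.Quotient.mk I p) = 0 := fun v p hp => by
    rw [Ideal.Quotient.eq_zero_iff_mem.mpr hp, map_zero]
  have htotal : ∀ a b : R, a ∣ b ∨ b ∣ a := by
    intro a b
    rcases eq_or_ne a 0 with rfl | ha
    · exact Or.inr (dvd_zero b)
    rcases eq_or_ne b 0 with rfl | hb
    · exact Or.inl (dvd_zero a)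
    obtain ⟨m, u, hum, rfl⟩ := exists_eq_pow_mul_isUnit hu ha
    obtain ⟨m', u', hum', rfl⟩ := exists_eq_pow_mul_isUnit hu hb
    rw [hum.mul_right_dvd, hum'.dvd_mul_right, hum'.mul_right_dvd, hum.dvd_mul_right]
    exact (le_total m m').imp (pow_dvd_pow x) (pow_dvd_pow x)
  let J : Matrix (Fin r) (Fin n) R :=
    Matrix.of fun i k => MvPolynomial.aeval y (MvPolynomial.pderiv k (f i))
  have hJe : (J.submatrix id e).det = v₀ (Ideal.Quotient.mk I (jacobianMinor f e)) := by
    rw [← hat, jacobianMinor, AlgHom.map_det]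
    rfl
  obtain ⟨g, hg⟩ := Matrix.exists_det_submatrix_dvd htotal J e
  have hge := hg e
  rw [hJe] at hge
  rw [map_mul, map_mul] at hNM
  have hd0 : (J.submatrix id g).det ≠ 0 := by
    intro h
    rw [h, zero_dvd_iff] at hge
    rw [hge] at hNM
    simp at hNM
  have hdt : (J.submatrix id g).det * x ∣ t := by
    obtain ⟨m, u, hum, hmu⟩ := exists_eq_pow_mul_isUnit hu hd0
    -- The chosen minor divides the given one, so `m ≥ c` would make `x^c` divide `NM` at `y`.
    have hmc : m < c := by
      by_contra! hcm
      refine hNM (Dvd.dvd.mul_left (((pow_dvd_pow x hcm).trans ?_).trans hge) _)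
      rw [hmu]
      exact dvd_mul_right _ _
    rw [hmu, mul_right_comm, hum.mul_right_dvd, ← pow_succ]
    exact pow_dvd_pow x (by omega)
  choose Q hQ using fun i => MvPolynomial.exists_aeval_add_mul_eq (f i) y t
  obtain ⟨s, τ, hτ⟩ := existsUnique_mulVec_add_eq_zero J Q t g hg hd0 hdt
  have hfJ : ∀ (w : Fin n → R) i, MvPolynomial.aeval (fun k => y k + t * w k) (f i) =
      t * (∑ k, J i k * w k + t * MvPolynomial.eval w (Q i)) := fun w i => by
    rw [hQ, hat, hroot v₀ _ (hf i)]
    simp only [J, Matrix.of_apply]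
    ring
  refine ⟨s, fun j => Ideal.Quotient.mk I (MvPolynomial.X (τ j)), fun z => ?_⟩
  obtain ⟨w, ⟨hw, hwz⟩, huniq⟩ := hτ z
  have hcong : ∀ p : MvPolynomial (Fin n) A,
      t ∣ MvPolynomial.aeval (fun k => y k + t * w k) p - v₀ (Ideal.Quotient.mk I p) := by
    intro p
    obtain ⟨q, hq⟩ := MvPolynomial.exists_aeval_add_mul_eq p y t
    rw [hq, hat]
    exact ⟨∑ k, MvPolynomial.aeval y (MvPolynomial.pderiv k p) * w k +
      t * MvPolynomial.eval w q, by ring⟩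
  -- The values of `N` at `y + t w` and at `y` agree modulo `t`, hence modulo `x^c`, which does not
  -- divide the latter.
  have hN0 : MvPolynomial.aeval (fun k => y k + t * w k) N ≠ 0 := by
    intro h0
    have := hcong N
    rw [h0, zero_sub, dvd_neg] at this
    exact hNM (Dvd.dvd.mul_right ((pow_dvd_pow x (by omega)).trans this) _)
  have hI : ∀ p ∈ I, MvPolynomial.aeval (fun k => y k + t * w k) p = 0 := by
    intro p hp
    have hspan : Ideal.span (Set.range f) ≤
        RingHom.ker (MvPolynomial.aeval (fun k => y k + t * w k) :
          MvPolynomial (Fin n) A →ₐ[A] R) := by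
      rw [Ideal.span_le]
      rintro _ ⟨i, rfl⟩
      exact (hfJ w i).trans (by rw [hw, mul_zero])
    have h1 : N * p ∈ Ideal.span (Set.range f) := Submodule.mem_colon.mp hN p hp
    have h2 := hspan h1
    rw [RingHom.mem_ker, map_mul] at h2
    exact (mul_eq_zero.mp h2).resolve_left hN0
  refine ⟨Ideal.Quotient.liftₐ I (MvPolynomial.aeval fun k => y k + t * w k) hI, ⟨?_, ?_⟩, ?_⟩
  · intro b
    obtain ⟨p, rfl⟩ := Ideal.Quotient.mk_surjective b
    exact hcong p
  · intro j
    rw [← hwz]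
    exact MvPolynomial.aeval_X _ _
  · rintro v' ⟨hv', hv'z⟩
    choose w' hw' using fun k => hv' (Ideal.Quotient.mk I (MvPolynomial.X k))
    have hv'X : ∀ k, v' (Ideal.Quotient.mk I (MvPolynomial.X k)) = y k + t * w' k := fun k => by
      rw [← hw' k]
      ring
    have hww : w' = w := by
      refine huniq w' ⟨fun i => ?_, fun j => ?_⟩
      · apply (mul_eq_zero.mp _).resolve_left ht0
        rw [← hfJ, ← hroot v' (f i) (hf i), ← hat v']
        simp only [hv'X]
      · have := hv'z j
        rw [hv'X] at this
        exact mul_left_cancel₀ ht0 (add_left_cancel this)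
    refine Ideal.Quotient.algHom_ext A (MvPolynomial.algHom_ext fun k => ?_)
    change v' (Ideal.Quotient.mk I (MvPolynomial.X k)) = MvPolynomial.aeval _ (MvPolynomial.X k)
    rw [hv'X, hww, MvPolynomial.aeval_X]

/-! ### The completion of a discrete valuation ring -/

section Completion

variable {A : Type*} [CommRing A] [IsDomain A] [IsDiscreteValuationRing A]

theorem LocalCompletion.maximalIdeal_eq_span {x : A} (hx : Irreducible x) :
    IsLocalRing.maximalIdeal (LocalCompletion A) =
      Ideal.span {algebraMap A (LocalCompletion A) x} := by
  have h := congrArg (Ideal.map (algebraMap A (LocalCompletion A))) hx.maximalIdeal_eq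
  rw [Ideal.map_span, Set.image_singleton] at h
  exact AdicCompletion.maximalIdeal_eq_map.trans h

theorem LocalCompletion.isAdicComplete_span {x : A} (hx : Irreducible x) :
    IsAdicComplete (Ideal.span {algebraMap A (LocalCompletion A) x}) (LocalCompletion A) := by
  rw [← maximalIdeal_eq_span hx]
  infer_instance

theorem LocalCompletion.isUnit_of_not_dvd {x : A} (hx : Irreducible x) {a : LocalCompletion A}
    (ha : ¬ algebraMap A (LocalCompletion A) x ∣ a) : IsUnit a := by
  rw [← Ideal.mem_span_singleton, ← maximalIdeal_eq_span hx] at ha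
  exact IsLocalRing.notMem_maximalIdeal.mp ha

theorem LocalCompletion.algebraMap_injective :
    Function.Injective (algebraMap A (LocalCompletion A)) := by
  have : IsHausdorff (IsLocalRing.maximalIdeal A) A := inferInstance
  exact AdicCompletion.of_injective (IsLocalRing.maximalIdeal A) A

/-- Nonzero elements are units times powers of `x`, and no power of `x` vanishes because `A` embeds.
-/
theorem LocalCompletion.isDomain : IsDomain (LocalCompletion A) := by
  obtain ⟨x, hx⟩ := IsDiscreteValuationRing.exists_irreducible A
  have := isAdicComplete_span hx
  have : NoZeroDivisors (LocalCompletion A) := ⟨fun {a b} hab => by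
    by_contra! h
    obtain ⟨m, u, hu, rfl⟩ := exists_eq_pow_mul_isUnit (fun _ => isUnit_of_not_dvd hx) h.1
    obtain ⟨k, w, hw, rfl⟩ := exists_eq_pow_mul_isUnit (fun _ => isUnit_of_not_dvd hx) h.2
    rw [mul_mul_mul_comm, (hu.mul hw).mul_left_eq_zero, ← pow_add, ← map_pow] at hab
    exact pow_ne_zero _ hx.ne_zero
      (algebraMap_injective (hab.trans (map_zero _).symm))⟩
  exact NoZeroDivisors.to_isDomain _

end Completion

theorem theorem2 {A : Type*} [CommRing A] [IsDomain A] [IsDiscreteValuationRing A]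
    (x : A) (hx : Irreducible x)
    {n r : ℕ} (c : ℕ)
    (I : Ideal (MvPolynomial (Fin n) A))
    (v : (MvPolynomial (Fin n) A ⧸ I) →ₐ[A] LocalCompletion A ⧸ powIdeal x (2 * c + 1))
    (f : Fin r → MvPolynomial (Fin n) A) (hf : ∀ i, f i ∈ I)
    (e : Fin r ↪o Fin n)
    (N : MvPolynomial (Fin n) A)
    (hN : N ∈ (Ideal.span (Set.range f)).colon (I : Set (MvPolynomial (Fin n) A)))
    (hNM : v (Ideal.Quotient.mk I (N * jacobianMinor f e)) ∉
      (powIdeal x c).map (Ideal.Quotient.mk (powIdeal x (2 * c + 1))))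
    (hne : (liftSet x (2 * c + 1) v).Nonempty) :
    ∃ (s : ℕ) (Z : Fin s → MvPolynomial (Fin n) A ⧸ I),
      ∀ v₀ ∈ liftSet x (2 * c + 1) v,
        ∃ φ : (Fin s → LocalCompletion A) → ((MvPolynomial (Fin n) A ⧸ I) →ₐ[A] LocalCompletion A),
          Set.BijOn φ Set.univ (liftSet x (2 * c + 1) v) ∧
          ∀ (z : Fin s → LocalCompletion A) (j : Fin s),
            φ z (Z j) = v₀ (Z j) + algebraMap A (LocalCompletion A) x ^ (2 * c + 1) * z j := by
  have := LocalCompletion.isDomain (A := A)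
  have := LocalCompletion.isAdicComplete_span hx
  set π := algebraMap A (LocalCompletion A) x
  have hπ0 : π ≠ 0 := fun h => hx.ne_zero
    (LocalCompletion.algebraMap_injective (h.trans (map_zero _).symm))
  have ht0 : π ^ (2 * c + 1) ≠ 0 := pow_ne_zero _ hπ0
  obtain ⟨v₁, hv₁⟩ := hne
  have hmem : ∀ v₀ ∈ liftSet x (2 * c + 1) v, ∀ v', v' ∈ liftSet x (2 * c + 1) v ↔
      ∀ b, π ^ (2 * c + 1) ∣ v' b - v₀ b := by
    intro v₀ hv₀ v'
    refine forall_congr' fun b => ?_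
    rw [← hv₀ b, Ideal.Quotient.eq, powIdeal, Ideal.mem_span_singleton]
  have hNM' : ¬ π ^ c ∣ v₁ (Ideal.Quotient.mk I (N * jacobianMinor f e)) := by
    intro h
    rw [← hv₁] at hNM
    exact hNM (Ideal.mem_map_of_mem _ (Ideal.mem_span_singleton.mpr h))
  obtain ⟨s, Z, hZ⟩ := existsUnique_algHom_of_jacobianMinor hπ0
    (fun _ => LocalCompletion.isUnit_of_not_dvd hx) c I v₁ f hf e N hN hNM'
  refine ⟨s, Z, fun v₀ hv₀ => ?_⟩
  choose a ha using fun j => (hmem v₁ hv₁ v₀).mp hv₀ (Z j)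
  have hZ₀ : ∀ z : Fin s → LocalCompletion A, ∃! v', v' ∈ liftSet x (2 * c + 1) v ∧
      ∀ j, v' (Z j) = v₀ (Z j) + π ^ (2 * c + 1) * z j := by
    intro z
    -- The `Z_j` come from `v₁` alone; passing to another base point `v₀` only translates the
    -- parameter by `a`.
    have hz : ∀ j, v₀ (Z j) + π ^ (2 * c + 1) * z j =
        v₁ (Z j) + π ^ (2 * c + 1) * (a + z) j := fun j => by
      rw [Pi.add_apply, mul_add, ← ha]
      ring
    simp only [hmem v₁ hv₁, hz]
    exact hZ (a + z)
  choose φ hφ huniq using hZ₀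
  refine ⟨φ, ⟨fun z _ => (hφ z).1, fun z _ z' _ h => ?_, fun v' hv' => ?_⟩, fun z => (hφ z).2⟩
  · funext j
    have h1 := (hφ z).2 j
    rw [h, (hφ z').2 j] at h1
    exact (mul_left_cancel₀ ht0 (add_left_cancel h1)).symm
  · choose z hz using fun j => (hmem v₀ hv₀ v').mp hv' (Z j)
    refine ⟨z, trivial, (huniq z v' ⟨hv', fun j => ?_⟩).symm⟩
    rw [← hz j]
    ring
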